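/- All graphs are finite, simple and undirected, with at least one vertex. For a graph $G$ with vertices $v_1,\dots,v_n$ of degrees $d_1,\dots,d_n$, let $A(G)$ be the adjacency matrix, $D(G)=\operatorname{diag}(d_1,\dots,d_n)$, $L(G)=D(G)-A(G)$, $Q(G)=D(G)+A(G)$, and let $\mathcal L(G)$ be the normalized Laplacian: its $(i,i)$ entry is $1$ if $d_i\neq 0$, its $(i,j)$ entry is $-1/\sqrt{d_id_j}$ if $v_i$ and $v_j$ are adjacent, and all its other entries are $0$. For $X\in\{A,L,Q,\mathcal L\}$, two graphs are $X$-cospectral if the characteristic polynomials of their matrices $X$ have the same roots, counted with multiplicities. Two regular graphs of the same degree are called cospectral if they are $X$-cospectral for some $X\in\{A,L,Q,\mathcal L\}$ (equivalently, for all four). The NS join (neighbors splitting join) $G_1\veebar G_2$ of vertex-disjoint graphs $G_1$, $G_2$ with $V(G_1)=\{u_1,\dots,u_n\}$ is obtained from the join $G_1\vee G_2$ (the disjoint union of $G_1$ and $G_2$ together with all edges between $V(G_1)$ and $V(G_2)$) by adding new vertices $u_1',\dots,u_n'$ and connecting $u_i'$ to $u_j$ if and only if $u_i$ and $u_j$ are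 adjacent in $G_1$. **Corollary.** For $i=1,2$ let $G_i$ and $H_i$ be $r_i$-regular graphs. Suppose that $G_1$ and $H_1$ are cospectral, and that $G_2$ and $H_2$ are cospectral and non-isomorphic. Then $G_1\veebar G_2$ and $H_1\veebar H_2$ are both non-regular, they are not isomorphic, and they are $X$-cospectral for every $X\in\{A,L,Q,\mathcal L\}$. -/

import Mathlib

/-- The NS (neighbors splitting) join of `G₁` and `G₂`, also called the splitting `V`-vertex join:
take the join of `G₁` and `G₂` (vertices `inl (inl u)` for `u : V₁`, and `inl (inr v)` for
`v : V₂`), add one new vertex `u' = inr u` for every vertex `u` of `G₁`, and connect `u'` to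
a vertex `w` of `G₁` if and only if `u` and `w` are adjacent in `G₁`. -/
def nsJoin {V₁ V₂ : Type*} (G₁ : SimpleGraph V₁) (G₂ : SimpleGraph V₂) :
    SimpleGraph ((V₁ ⊕ V₂) ⊕ V₁) where
  Adj
    | .inl (.inl u), .inl (.inl w) => G₁.Adj u w
    | .inl (.inr v), .inl (.inr w) => G₂.Adj v w
    | .inl (.inl _), .inl (.inr _) => True
    | .inl (.inr _), .inl (.inl _) => True
    | .inr u, .inl (.inl w) => G₁.Adj u w
    | .inl (.inl w), .inr u => G₁.Adj u w
    | .inr _, .inl (.inr _) => False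
    | .inl (.inr _), .inr _ => False
    | .inr _, .inr _ => False
  symm := ⟨by
    rintro ((u | v) | u) ((u' | v') | u') h
    all_goals first
      | exact h
      | exact h.symm⟩
  loopless := ⟨by
    rintro ((u | v) | u) h
    · exact G₁.loopless.irrefl u h
    · exact G₂.loopless.irrefl v h
    · exact h⟩

instance nsJoin.instDecidableRelAdj {V₁ V₂ : Type*} (G₁ : SimpleGraph V₁) (G₂ : SimpleGraph V₂)
    [DecidableRel G₁.Adj] [DecidableRel G₂.Adj] : DecidableRel (nsJoin G₁ G₂).Adj
  | .inl (.inl u), .inl (.inl w) => inferInstanceAs (Decidable (G₁.Adj u w))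
  | .inl (.inr v), .inl (.inr w) => inferInstanceAs (Decidable (G₂.Adj v w))
  | .inl (.inl _), .inl (.inr _) => inferInstanceAs (Decidable True)
  | .inl (.inr _), .inl (.inl _) => inferInstanceAs (Decidable True)
  | .inr u, .inl (.inl w) => inferInstanceAs (Decidable (G₁.Adj u w))
  | .inl (.inl w), .inr u => inferInstanceAs (Decidable (G₁.Adj u w))
  | .inr _, .inl (.inr _) => inferInstanceAs (Decidable False)
  | .inl (.inr _), .inr _ => inferInstanceAs (Decidable False)
  | .inr _, .inr _ => inferInstanceAs (Decidable False)

/-- The signless Laplacian matrix `Q = D + A`. -/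
def signlessLapMatrix {V : Type*} [Fintype V] [DecidableEq V] (G : SimpleGraph V)
    [DecidableRel G.Adj] : Matrix V V ℝ :=
  G.degMatrix ℝ + G.adjMatrix ℝ

/-- The normalized Laplacian matrix: the diagonal entry at `i` is `1` if `i` has nonzero degree,
the entry at two adjacent vertices `i`, `j` is `-1 / √(dᵢ dⱼ)`, all other entries are `0`. -/
noncomputable def normalizedLapMatrix {V : Type*} [Fintype V] [DecidableEq V] (G : SimpleGraph V)
    [DecidableRel G.Adj] : Matrix V V ℝ :=
  Matrix.of fun i j =>
    if i = j ∧ G.degree i ≠ 0 then 1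
    else if G.Adj i j then -(1 / Real.sqrt ((G.degree i : ℝ) * (G.degree j : ℝ)))
    else 0

/-- The four kinds of matrices associated with a graph. -/
inductive GraphMatrixKind : Type
  | adjacency
  | laplacian
  | signlessLaplacian
  | normalizedLaplacian

/-- The real matrix of kind `X` associated with the graph `G`. -/
noncomputable def graphMatrix (X : GraphMatrixKind) {V : Type*} [Fintype V] [DecidableEq V]
    (G : SimpleGraph V) [DecidableRel G.Adj] : Matrix V V ℝ :=
  match X with
  | .adjacency => G.adjMatrix ℝ
  | .laplacian => G.lapMatrix ℝ
  | .signlessLaplacian => signlessLapMatrix G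
  | .normalizedLaplacian => normalizedLapMatrix G

/-- The `X`-spectrum of `G`: the multiset of the roots, with multiplicities, of the characteristic
polynomial of the matrix of kind `X`. (All four matrices are real symmetric, so that
all complex roots are real.) -/
noncomputable def graphSpectrum (X : GraphMatrixKind) {V : Type*} [Fintype V] [DecidableEq V]
    (G : SimpleGraph V) [DecidableRel G.Adj] : Multiset ℝ :=
  (graphMatrix X G).charpoly.roots

/-- `G` and `H` are `X`-cospectral if they have the same `X`-spectrum. -/
def Cospectral (X : GraphMatrixKind) {V W : Type*} [Fintype V] [DecidableEq V]
    [Fintype W] [DecidableEq W] (G : SimpleGraph V) [DecidableRel G.Adj]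
    (H : SimpleGraph W) [DecidableRel H.Adj] : Prop :=
  graphSpectrum X G = graphSpectrum X H

/-! Cospectrality: for regular factors, every one of the four matrices of the NS join has blocks
that combine `A₁`, `A₂`, the identity and all-ones matrices, with scalars depending only on degrees
and orders. If orthogonal `P₁`, `P₂` intertwine the adjacency matrices of the factors and fix the
all-ones vector, then `diag(P₁, P₂, P₁)` intertwines the block matrices (`charpoly_nsBlock_eq`).
Such `Pᵢ` come from the spectral theorem, corrected by a Householder reflection
(`exists_orthogonal_fixing_one`).

Non-isomorphism: the new vertices are exactly those of degree `r₁`, so isomorphisms preserve them.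
If `r₁ > 0`, the first factor consists of their neighbours, and the second factor is what remains.
If `r₁ = 0`, the first factor may be moved into the second, but only as an independent set joined to
everything else, which can be swapped back (`nonempty_iso_of_nsJoin_iso`). -/

open Matrix

/-! ### Orthogonal similarity fixing the all-ones vector -/

/-- A Householder reflection exchanging two vectors of the same length, and commuting with
any symmetric matrix for which both are eigenvectors with the same eigenvalue. -/
theorem exists_orthogonal_commute_mulVec_eq {V : Type*} [Fintype V] [DecidableEq V]
    (B : Matrix V V ℝ) (hB : Bᵀ = B) (x y : V → ℝ) (r : ℝ) (hx : B *ᵥ x = r • x)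
    (hy : B *ᵥ y = r • y) (hxy : x ⬝ᵥ x = y ⬝ᵥ y) :
    ∃ R : Matrix V V ℝ, Rᵀ * R = 1 ∧ R * Rᵀ = 1 ∧ R *ᵥ x = y ∧ R * B = B * R := by
  by_cases hv : x - y = 0
  · exact ⟨1, by simp, by simp, by simpa using sub_eq_zero.1 hv, by simp⟩
  set v := x - y with hvdef
  have hvv : v ⬝ᵥ v ≠ 0 := by simpa [dotProduct_self_eq_zero] using hv
  set c : ℝ := 2 / (v ⬝ᵥ v) with hc
  have hBv : B *ᵥ v = r • v := by rw [hvdef, mulVec_sub, hx, hy, smul_sub]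
  have hvB : v ᵥ* B = r • v := by rw [← mulVec_transpose, hB, hBv]
  have hT : (1 - c • vecMulVec v v)ᵀ = 1 - c • vecMulVec v v := by
    simp [transpose_vecMulVec]
  have hsq : (1 - c • vecMulVec v v) * (1 - c • vecMulVec v v) = 1 := by
    have h2 : vecMulVec v v * vecMulVec v v = (v ⬝ᵥ v) • vecMulVec v v := by
      rw [vecMulVec_mul_vecMulVec, vecMulVec_smul]
    have h3 : c * c * (v ⬝ᵥ v) = c + c := by rw [hc]; field_simp; ring
    simp only [sub_mul, mul_sub, one_mul, mul_one, smul_mul_assoc]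
    rw [mul_smul_comm, h2, smul_smul, smul_smul, h3, add_smul]
    abel
  refine ⟨1 - c • vecMulVec v v, by rw [hT, hsq], by rw [hT, hsq], ?_, ?_⟩
  -- Equal lengths give `|x - y|² = 2 (x - y)·x`, so the reflection sends `x` to `x - v = y`.
  · have hvx : c * (v ⬝ᵥ x) = 1 := by
      have : v ⬝ᵥ v = 2 * (v ⬝ᵥ x) := by
        simp only [hvdef, sub_dotProduct, dotProduct_sub, dotProduct_comm x y] at *
        linarith
      rw [hc, div_mul_eq_mul_div, ← this, div_self hvv]
    rw [sub_mulVec, one_mulVec, smul_mulVec, vecMulVec_mulVec]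
    ext i
    have := hvx
    simp [hvdef] at this ⊢
    linear_combination (-(x i - y i)) * this
  · rw [sub_mul, mul_sub, one_mul, mul_one, smul_mul_assoc, mul_smul_comm, vecMulVec_mul,
      mul_vecMulVec, hBv, hvB, vecMulVec_smul, smul_vecMulVec]

theorem charpoly_eq_of_roots_eq {V W : Type*} [Fintype V] [DecidableEq V] [Fintype W]
    [DecidableEq W] {A : Matrix V V ℝ} {B : Matrix W W ℝ} (hA : A.IsHermitian)
    (hB : B.IsHermitian) (h : A.charpoly.roots = B.charpoly.roots) : A.charpoly = B.charpoly := by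
  rw [hA.splits_charpoly.eq_prod_roots_of_monic (charpoly_monic A),
    hB.splits_charpoly.eq_prod_roots_of_monic (charpoly_monic B), h]

theorem card_eq_of_roots_charpoly_eq {V W : Type*} [Fintype V] [DecidableEq V] [Fintype W]
    [DecidableEq W] {A : Matrix V V ℝ} {B : Matrix W W ℝ} (hA : A.IsHermitian)
    (hB : B.IsHermitian) (h : A.charpoly.roots = B.charpoly.roots) :
    Fintype.card V = Fintype.card W := by
  have := congrArg Multiset.card h
  simpa [hA.roots_charpoly_eq_eigenvalues, hB.roots_charpoly_eq_eigenvalues] using this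

/-- Symmetric real matrices with the same characteristic polynomial are orthogonally similar. -/
theorem exists_orthogonal_of_charpoly_eq {V : Type*} [Fintype V] [DecidableEq V]
    {A B : Matrix V V ℝ} (hA : A.IsHermitian) (hB : B.IsHermitian)
    (h : A.charpoly = B.charpoly) :
    ∃ P : Matrix V V ℝ, Pᵀ * P = 1 ∧ P * Pᵀ = 1 ∧ P * A = B * P := by
  -- Eigenvalues are listed in a fixed order, so one diagonal matrix `D` serves both.
  have he := (hA.eigenvalues_eq_eigenvalues_iff hB).2 h
  set U : Matrix V V ℝ := (hA.eigenvectorUnitary).1 with hU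
  set U' : Matrix V V ℝ := (hB.eigenvectorUnitary).1 with hU'
  set D : Matrix V V ℝ := diagonal hA.eigenvalues with hD
  have hAs : A = U * D * Uᵀ := by
    have := hA.spectral_theorem
    rw [Unitary.conjStarAlgAut_apply] at this
    exact this
  have hBs : B = U' * D * U'ᵀ := by
    have := hB.spectral_theorem
    rw [Unitary.conjStarAlgAut_apply, ← he] at this
    exact this
  have u1 : Uᵀ * U = 1 := Unitary.coe_star_mul_self hA.eigenvectorUnitary
  have u2 : U * Uᵀ = 1 := Unitary.coe_mul_star_self hA.eigenvectorUnitary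
  have u3 : U'ᵀ * U' = 1 := Unitary.coe_star_mul_self hB.eigenvectorUnitary
  have u4 : U' * U'ᵀ = 1 := Unitary.coe_mul_star_self hB.eigenvectorUnitary
  clear_value U U' D
  refine ⟨U' * Uᵀ, ?_, ?_, ?_⟩
  · rw [transpose_mul, transpose_transpose, Matrix.mul_assoc, ← Matrix.mul_assoc U'ᵀ, u3,
      Matrix.one_mul, u2]
  · rw [transpose_mul, transpose_transpose, Matrix.mul_assoc, ← Matrix.mul_assoc Uᵀ, u1,
      Matrix.one_mul, u4]
  · rw [hAs, hBs]
    calc U' * Uᵀ * (U * D * Uᵀ) = U' * ((Uᵀ * U) * D * Uᵀ) := by simp only [Matrix.mul_assoc]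
      _ = U' * D * ((U'ᵀ * U') * Uᵀ) := by
        rw [u1, u3]; simp only [Matrix.mul_assoc, Matrix.one_mul]
      _ = _ := by simp only [Matrix.mul_assoc]

/-- Symmetric real matrices with the same spectrum and the same constant row sum are similar by
an orthogonal matrix that fixes the all-ones vector. -/
theorem exists_orthogonal_fixing_one {V W : Type*} [Fintype V] [DecidableEq V] [Fintype W]
    [DecidableEq W] {A : Matrix V V ℝ} {B : Matrix W W ℝ} (hA : A.IsHermitian)
    (hB : B.IsHermitian) (h : A.charpoly.roots = B.charpoly.roots) (r : ℝ)
    (hA1 : A *ᵥ 1 = r • 1) (hB1 : B *ᵥ 1 = r • 1) :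
    ∃ P : Matrix W V ℝ, Pᵀ * P = 1 ∧ P * Pᵀ = 1 ∧ P *ᵥ 1 = 1 ∧ P * A = B * P := by
  let e : V ≃ W := Fintype.equivOfCardEq (card_eq_of_roots_charpoly_eq hA hB h)
  have hch : A.charpoly = (B.submatrix e e).charpoly := by
    rw [charpoly_eq_of_roots_eq hA hB h]
    exact (charpoly_reindex e.symm B).symm
  have hB' : (B.submatrix e e).IsHermitian := hB.submatrix e
  have hB1' : B.submatrix e e *ᵥ 1 = r • 1 := by
    ext i
    have := congrFun hB1 (e i)
    rw [submatrix_mulVec_equiv]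
    simpa using this
  obtain ⟨P, h1, h2, h3⟩ := exists_orthogonal_of_charpoly_eq hA hB' hch
  -- `P *ᵥ 1` and `1` are `r`-eigenvectors of the same length, so `R * P` still intertwines and now
  -- fixes `1`. The eigenvalue `r` need not be simple.
  obtain ⟨R, k1, k2, k3, k4⟩ := exists_orthogonal_commute_mulVec_eq (B.submatrix e e)
    (by simpa using! hB') (P *ᵥ 1) 1 r (by rw [mulVec_mulVec, ← h3, ← mulVec_mulVec, hA1,
      mulVec_smul]) hB1' (by
      rw [dotProduct_mulVec, vecMul_mulVec, h1, vecMul_one])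
  have q1 : (R * P)ᵀ * (R * P) = 1 := by
    rw [transpose_mul, Matrix.mul_assoc, ← Matrix.mul_assoc Rᵀ, k1, Matrix.one_mul, h1]
  have q2 : (R * P) * (R * P)ᵀ = 1 := by
    rw [transpose_mul, Matrix.mul_assoc, ← Matrix.mul_assoc P, h2, Matrix.one_mul, k2]
  have q3 : (R * P) *ᵥ 1 = 1 := by rw [← mulVec_mulVec, k3]
  have q4 : (R * P) * A = B.submatrix e e * (R * P) := by
    rw [Matrix.mul_assoc, h3, ← Matrix.mul_assoc, k4, Matrix.mul_assoc]
  clear k3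
  generalize R * P = S at *
  refine ⟨S.submatrix e.symm id, ?_, ?_, ?_, ?_⟩
  · rw [transpose_submatrix, submatrix_mul_equiv, q1]; simp
  · rw [transpose_submatrix, ← submatrix_mul _ _ e.symm id e.symm Function.bijective_id, q2]
    simp
  · ext i
    exact congrFun q3 (e.symm i)
  · have : (S * A).submatrix e.symm id = (B.submatrix e e * S).submatrix e.symm id := by
      rw [q4]
    rw [submatrix_mul _ _ e.symm id id Function.bijective_id,
      submatrix_mul _ _ e.symm e.symm id e.symm.bijective, submatrix_submatrix] at this
    simpa using this

/-- `A = Pᵀ(BP)` and `B = (BP)Pᵀ` are products of the same two factors in opposite order. -/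
theorem charpoly_eq_of_mul_eq_mul {V W : Type*} [Fintype V] [DecidableEq V] [Fintype W]
    [DecidableEq W] {A : Matrix V V ℝ} {B : Matrix W W ℝ} {P : Matrix W V ℝ}
    (hcard : Fintype.card V = Fintype.card W)
    (h1 : Pᵀ * P = 1) (h2 : P * Pᵀ = 1) (h : P * A = B * P) : A.charpoly = B.charpoly := by
  have hA : A = Pᵀ * (B * P) := by rw [← h, ← Matrix.mul_assoc, h1, Matrix.one_mul]
  have hB : B = (B * P) * Pᵀ := by rw [Matrix.mul_assoc, h2, Matrix.mul_one]
  have := charpoly_mul_comm_of_le Pᵀ (B * P) hcard.ge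
  rwa [← hA, ← hB, hcard, Nat.sub_self, pow_zero, one_mul] at this

theorem one_vecMul_of_orthogonal {V W : Type*} [Fintype V] [DecidableEq V] [Fintype W]
    {P : Matrix W V ℝ} (h1 : Pᵀ * P = 1) (h : P *ᵥ 1 = 1) : (1 : W → ℝ) ᵥ* P = 1 := by
  rw [← mulVec_transpose, ← h, mulVec_mulVec, h1, one_mulVec]

/-! ### Block matrices -/

/-- The all-ones matrix. -/
def onesMatrix (m n : Type*) : Matrix m n ℝ := vecMulVec 1 1

@[simp]
theorem onesMatrix_apply {m n : Type*} (i : m) (j : n) : onesMatrix m n i j = 1 := by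
  simp [onesMatrix, vecMulVec_apply]

/-- Both sides equal the all-ones matrix, because orthogonality turns `P₂ 1 = 1` into `1ᵀ P₂ = 1ᵀ`.
-/
theorem mul_onesMatrix {V₁ W₁ V₂ W₂ : Type*} [Fintype V₁] [Fintype V₂]
    [DecidableEq V₂] [Fintype W₂] {P₁ : Matrix W₁ V₁ ℝ} {P₂ : Matrix W₂ V₂ ℝ}
    (h1 : P₁ *ᵥ 1 = 1) (h2 : P₂ᵀ * P₂ = 1) (h3 : P₂ *ᵥ 1 = 1) :
    P₁ * onesMatrix V₁ V₂ = onesMatrix W₁ W₂ * P₂ := by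
  rw [onesMatrix, onesMatrix, mul_vecMulVec, h1, vecMulVec_mul, one_vecMul_of_orthogonal h2 h3]

/-- The block form shared by the matrices of an NS join of regular graphs. -/
def nsBlock {V₁ V₂ : Type*} [DecidableEq V₁] [DecidableEq V₂] (a b c d e f g : ℝ)
    (A₁ : Matrix V₁ V₁ ℝ) (A₂ : Matrix V₂ V₂ ℝ) :
    Matrix ((V₁ ⊕ V₂) ⊕ V₁) ((V₁ ⊕ V₂) ⊕ V₁) ℝ :=
  fromBlocks
    (fromBlocks (a • A₁ + b • 1) (c • onesMatrix V₁ V₂) (c • onesMatrix V₂ V₁) (e • A₂ + f • 1))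
    (fromRows (d • A₁) 0) (fromCols (d • A₁) 0) (g • 1)

theorem charpoly_nsBlock_eq {V₁ V₂ W₁ W₂ : Type*}
    [Fintype V₁] [DecidableEq V₁] [Fintype V₂] [DecidableEq V₂]
    [Fintype W₁] [DecidableEq W₁] [Fintype W₂] [DecidableEq W₂]
    {A₁ : Matrix V₁ V₁ ℝ} {A₂ : Matrix V₂ V₂ ℝ} {B₁ : Matrix W₁ W₁ ℝ} {B₂ : Matrix W₂ W₂ ℝ}
    {P₁ : Matrix W₁ V₁ ℝ} {P₂ : Matrix W₂ V₂ ℝ} (hc₁ : Fintype.card V₁ = Fintype.card W₁)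
    (hc₂ : Fintype.card V₂ = Fintype.card W₂)
    (h1 : P₁ᵀ * P₁ = 1) (h2 : P₁ * P₁ᵀ = 1) (h3 : P₁ *ᵥ 1 = 1) (h4 : P₁ * A₁ = B₁ * P₁)
    (k1 : P₂ᵀ * P₂ = 1) (k2 : P₂ * P₂ᵀ = 1) (k3 : P₂ *ᵥ 1 = 1) (k4 : P₂ * A₂ = B₂ * P₂)
    (a b c d e f g : ℝ) :
    (nsBlock a b c d e f g A₁ A₂).charpoly = (nsBlock a b c d e f g B₁ B₂).charpoly := by
  refine charpoly_eq_of_mul_eq_mul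
    (P := fromBlocks (fromBlocks P₁ 0 0 P₂) 0 0 P₁) (by simp [hc₁, hc₂]) ?_ ?_ ?_
  · simp [fromBlocks_transpose, fromBlocks_multiply, h1, k1]
  · simp [fromBlocks_transpose, fromBlocks_multiply, h2, k2]
  · simp [nsBlock, fromBlocks_multiply, fromBlocks_mul_fromRows, fromCols_mul_fromBlocks,
      Matrix.mul_add, Matrix.add_mul, h4, k4, mul_onesMatrix h3 k1 k3,
      mul_onesMatrix k3 h1 h3, fromRows_mul, mul_fromCols]

/-! ### Adjacency and degrees in the NS join -/

open SimpleGraph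

section Adj

variable {V₁ V₂ : Type*} {G₁ : SimpleGraph V₁} {G₂ : SimpleGraph V₂}

@[simp]
theorem nsJoin_adj_inl_inl_inl_inl {u w : V₁} :
    (nsJoin G₁ G₂).Adj (.inl (.inl u)) (.inl (.inl w)) ↔ G₁.Adj u w := Iff.rfl

@[simp]
theorem nsJoin_adj_inl_inr_inl_inr {v w : V₂} :
    (nsJoin G₁ G₂).Adj (.inl (.inr v)) (.inl (.inr w)) ↔ G₂.Adj v w := Iff.rfl

@[simp]
theorem nsJoin_adj_inl_inl_inl_inr {u : V₁} {v : V₂} :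
    (nsJoin G₁ G₂).Adj (.inl (.inl u)) (.inl (.inr v)) ↔ True := Iff.rfl

@[simp]
theorem nsJoin_adj_inl_inr_inl_inl {u : V₁} {v : V₂} :
    (nsJoin G₁ G₂).Adj (.inl (.inr v)) (.inl (.inl u)) ↔ True := Iff.rfl

@[simp]
theorem nsJoin_adj_inr_inl_inl {u w : V₁} :
    (nsJoin G₁ G₂).Adj (.inr u) (.inl (.inl w)) ↔ G₁.Adj u w := Iff.rfl

@[simp]
theorem nsJoin_adj_inl_inl_inr {u w : V₁} :
    (nsJoin G₁ G₂).Adj (.inl (.inl w)) (.inr u) ↔ G₁.Adj u w := Iff.rfl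

@[simp]
theorem nsJoin_adj_inr_inl_inr {u : V₁} {v : V₂} :
    (nsJoin G₁ G₂).Adj (.inr u) (.inl (.inr v)) ↔ False := Iff.rfl

@[simp]
theorem nsJoin_adj_inl_inr_inr {u : V₁} {v : V₂} :
    (nsJoin G₁ G₂).Adj (.inl (.inr v)) (.inr u) ↔ False := Iff.rfl

@[simp]
theorem nsJoin_adj_inr_inr {u w : V₁} :
    (nsJoin G₁ G₂).Adj (.inr u) (.inr w) ↔ False := Iff.rfl

end Adj

theorem sum_if_adj_of_regular {V : Type*} [Fintype V] {G : SimpleGraph V}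
    [DecidableRel G.Adj] {r : ℕ} (h : G.IsRegularOfDegree r) (u : V) :
    ∑ j, (if G.Adj u j then 1 else 0) = r := by
  rw [← h u]
  exact (degree_eq_sum_if_adj G (R := ℕ) u).symm

theorem nsJoin_degree_eq_sum {V₁ V₂ : Type*} [Fintype V₁] [Fintype V₂]
    {G₁ : SimpleGraph V₁} [DecidableRel G₁.Adj] {G₂ : SimpleGraph V₂} [DecidableRel G₂.Adj] (x : (V₁ ⊕ V₂) ⊕ V₁) :
    (nsJoin G₁ G₂).degree x =
      ((∑ u, if (nsJoin G₁ G₂).Adj x (.inl (.inl u)) then 1 else 0) +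
        ∑ v, if (nsJoin G₁ G₂).Adj x (.inl (.inr v)) then 1 else 0) +
        ∑ u, if (nsJoin G₁ G₂).Adj x (.inr u) then 1 else 0 := by
  have h := degree_eq_sum_if_adj (nsJoin G₁ G₂) (R := ℕ) x
  rw [Fintype.sum_sum_type, Fintype.sum_sum_type] at h
  exact h

section Degrees

variable {V₁ V₂ : Type*} [Fintype V₁] [Fintype V₂]
  {G₁ : SimpleGraph V₁} [DecidableRel G₁.Adj] {G₂ : SimpleGraph V₂} [DecidableRel G₂.Adj]
  {r₁ r₂ : ℕ}

theorem nsJoin_degree_inl_inl (h₁ : G₁.IsRegularOfDegree r₁) (u : V₁) :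
    (nsJoin G₁ G₂).degree (.inl (.inl u)) = 2 * r₁ + Fintype.card V₂ := by
  rw [nsJoin_degree_eq_sum]
  simp only [nsJoin_adj_inl_inl_inl_inl, nsJoin_adj_inl_inl_inl_inr, nsJoin_adj_inl_inl_inr,
    G₁.adj_comm _ u, sum_if_adj_of_regular h₁]
  simp
  ring

theorem nsJoin_degree_inl_inr (h₂ : G₂.IsRegularOfDegree r₂) (v : V₂) :
    (nsJoin G₁ G₂).degree (.inl (.inr v)) = r₂ + Fintype.card V₁ := by
  rw [nsJoin_degree_eq_sum]
  simp only [nsJoin_adj_inl_inr_inl_inl, nsJoin_adj_inl_inr_inl_inr, nsJoin_adj_inl_inr_inr,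
    sum_if_adj_of_regular h₂]
  simp [add_comm]

theorem nsJoin_degree_inr (h₁ : G₁.IsRegularOfDegree r₁) (u : V₁) :
    (nsJoin G₁ G₂).degree (.inr u) = r₁ := by
  rw [nsJoin_degree_eq_sum]
  simp only [nsJoin_adj_inr_inl_inl, nsJoin_adj_inr_inl_inr, nsJoin_adj_inr_inr,
    sum_if_adj_of_regular h₁]
  simp

theorem not_isRegularOfDegree_nsJoin [Nonempty V₁] [Nonempty V₂]
    (h₁ : G₁.IsRegularOfDegree r₁) : ¬ ∃ d : ℕ, (nsJoin G₁ G₂).IsRegularOfDegree d := by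
  rintro ⟨d, hd⟩
  obtain ⟨u⟩ := ‹Nonempty V₁›
  have h1 := hd (.inl (.inl u))
  have h2 := hd (.inr u)
  rw [nsJoin_degree_inl_inl h₁] at h1
  rw [nsJoin_degree_inr h₁] at h2
  have := Fintype.card_pos (α := V₂)
  omega

/-- The new vertices of an NS join of regular graphs are those of smallest degree. -/
theorem nsJoin_degree_eq_iff_isRight [Nonempty V₁] [Nonempty V₂]
    (h₁ : G₁.IsRegularOfDegree r₁) (h₂ : G₂.IsRegularOfDegree r₂) (x : (V₁ ⊕ V₂) ⊕ V₁) :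
    (nsJoin G₁ G₂).degree x = r₁ ↔ x.isRight := by
  have hpos := Fintype.card_pos (α := V₂)
  obtain ⟨u₀⟩ := ‹Nonempty V₁›
  -- `r₁ < |V₁|` rules out the degree `r₂ + |V₁|`; `|V₂| > 0` rules out `2 r₁ + |V₂|`.
  have hlt := G₁.degree_lt_card_verts u₀
  rw [h₁ u₀] at hlt
  rcases x with (u | v) | u
  · rw [nsJoin_degree_inl_inl h₁]; simp; omega
  · rw [nsJoin_degree_inl_inr h₂]; simp; omega
  · rw [nsJoin_degree_inr h₁]; simp

end Degrees

/-! ### Recovering the second factor -/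

theorem nonempty_iso_of_injective {V W : Type*} [Fintype V] [Fintype W] {G : SimpleGraph V}
    {H : SimpleGraph W} (hc : Fintype.card V = Fintype.card W) (g : V → W)
    (hg : Function.Injective g) (hadj : ∀ v v', H.Adj (g v) (g v') ↔ G.Adj v v') :
    Nonempty (G ≃g H) :=
  ⟨⟨Equiv.ofBijective g ((Fintype.bijective_iff_injective_and_card g).2 ⟨hg, hc⟩),
    fun {v v'} => hadj v v'⟩⟩

section Iso

variable {V₁ V₂ W₁ W₂ : Type*} {G₁ : SimpleGraph V₁} {G₂ : SimpleGraph V₂}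
  {H₁ : SimpleGraph W₁} {H₂ : SimpleGraph W₂}

/-- If an isomorphism of NS joins respects the vertices of the first factors, then it
restricts to the second factors. -/
theorem nonempty_iso_of_nsJoin_iso_of_inl [Fintype V₁] [Fintype V₂] [Fintype W₁] [Fintype W₂]
    (hc₁ : Fintype.card V₁ = Fintype.card W₁) (hc₂ : Fintype.card V₂ = Fintype.card W₂)
    (φ : nsJoin G₁ G₂ ≃g nsJoin H₁ H₂) (t : V₂ → W₁ ⊕ W₂)
    (ht : ∀ v, φ (.inl (.inr v)) = .inl (t v)) (s : V₁ → W₁)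
    (hs : ∀ u, φ (.inl (.inl u)) = .inl (.inl (s u))) : Nonempty (G₂ ≃g H₂) := by
  have hsinj : Function.Injective s := fun u u' h => by
    have : φ (.inl (.inl u)) = φ (.inl (.inl u')) := by rw [hs, hs, h]
    simpa using φ.injective this
  have hsurj := ((Fintype.bijective_iff_injective_and_card s).2 ⟨hsinj, hc₁⟩).2
  have hg : ∀ v, ∃ w, t v = .inr w := by
    intro v
    rcases h : t v with w | w
    -- The images of `V₁` already exhaust `W₁`.
    · obtain ⟨u, rfl⟩ := hsurj w
      have := φ.injective ((ht v).trans ((congrArg _ h).trans (hs u).symm))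
      simp at this
    · exact ⟨w, rfl⟩
  choose g hg using hg
  have htg : ∀ v, φ (.inl (.inr v)) = .inl (.inr (g v)) := fun v => by rw [ht, hg]
  refine nonempty_iso_of_injective hc₂ g (fun v v' h => ?_) fun v v' => ?_
  · have : φ (.inl (.inr v)) = φ (.inl (.inr v')) := by rw [htg, htg, h]
    simpa using φ.injective this
  · have := φ.map_adj_iff (v := .inl (.inr v)) (w := .inl (.inr v'))
    rw [htg, htg] at this
    exact this

/-- If an isomorphism of NS joins moves the vertices of an edgeless first factor into the second
factor, then exchanging them back gives an isomorphism of the second factors. -/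
theorem nonempty_iso_of_nsJoin_iso_of_inr [Fintype V₁] [Fintype V₂] [Fintype W₁] [Fintype W₂]
    (hc₁ : Fintype.card V₁ = Fintype.card W₁) (hc₂ : Fintype.card V₂ = Fintype.card W₂)
    (hG₁ : ∀ u u', ¬ G₁.Adj u u') (hH₁ : ∀ u u', ¬ H₁.Adj u u')
    (φ : nsJoin G₁ G₂ ≃g nsJoin H₁ H₂) (t : V₂ → W₁ ⊕ W₂)
    (ht : ∀ v, φ (.inl (.inr v)) = .inl (t v)) (s : V₁ → W₂)
    (hs : ∀ u, φ (.inl (.inl u)) = .inl (.inr (s u))) : Nonempty (G₂ ≃g H₂) := by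
  let e : W₁ ≃ V₁ := Fintype.equivOfCardEq hc₁.symm
  have hsinj : Function.Injective s := fun u u' h => by
    have := φ.injective ((hs u).trans ((congrArg _ (congrArg _ h)).trans (hs u').symm))
    simpa using this
  have htinj : Function.Injective t := fun v v' h => by
    have := φ.injective ((ht v).trans ((congrArg _ h).trans (ht v').symm))
    simpa using this
  have hts : ∀ v u, t v ≠ .inr (s u) := fun v u h => by
    have := φ.injective ((ht v).trans ((congrArg _ h).trans (hs u).symm))
    simp at this
  have hadj_t : ∀ v v', (nsJoin H₁ H₂).Adj (.inl (t v)) (.inl (t v')) ↔ G₂.Adj v v' := by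
    intro v v'
    rw [← ht, ← ht, φ.map_adj_iff]
    rfl
  have hadj_s : ∀ u u', ¬ H₂.Adj (s u) (s u') := by
    intro u u' h
    have := φ.map_adj_iff (v := .inl (.inl u)) (w := .inl (.inl u'))
    rw [hs, hs] at this
    exact hG₁ u u' (this.1 h)
  have hadj_ts : ∀ v u, (nsJoin H₁ H₂).Adj (.inl (t v)) (.inl (.inr (s u))) := by
    intro v u
    rw [← ht, ← hs, φ.map_adj_iff]
    trivial
  -- The image of `V₂` is `W₁` together with `W₂` minus `s(V₁)`. Both `W₁` and `s(V₁)` are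
  -- independent and joined to all of that remainder, so replacing `W₁` by `s(V₁)` preserves
  -- adjacency.
  refine nonempty_iso_of_injective hc₂ (fun v => Sum.elim (s ∘ e) id (t v))
    (fun v v' h => htinj ?_) fun v v' => ?_
  · rcases h1 : t v with w | w <;> rcases h2 : t v' with w' | w' <;>
      simp only [h1, h2, Sum.elim_inl, Sum.elim_inr, Function.comp, id] at h
    · rw [e.injective (hsinj h)]
    · exact (hts v' (e w) (by rw [h2, h])).elim
    · exact (hts v (e w') (by rw [h1, h])).elim
    · rw [h]
  · rw [← hadj_t]
    have k1 := hadj_ts v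
    have k2 := hadj_ts v'
    rcases h1 : t v with w | w <;> rcases h2 : t v' with w' | w' <;>
      simp only [h1, h2, Sum.elim_inl, Sum.elim_inr, Function.comp, id] at k1 k2 ⊢
    · exact iff_of_false (hadj_s _ _) (hH₁ _ _)
    · exact iff_of_true (k2 _).symm trivial
    · exact iff_of_true (k1 _) trivial
    · exact Iff.rfl

theorem nonempty_iso_of_nsJoin_iso [Fintype V₁] [Fintype V₂]
    [Fintype W₁] [Fintype W₂] [Nonempty V₁] [Nonempty V₂] [Nonempty W₁] [Nonempty W₂]
    [DecidableRel G₁.Adj] [DecidableRel G₂.Adj] [DecidableRel H₁.Adj] [DecidableRel H₂.Adj]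
    {r₁ r₂ : ℕ} (hG₁ : G₁.IsRegularOfDegree r₁) (hH₁ : H₁.IsRegularOfDegree r₁)
    (hG₂ : G₂.IsRegularOfDegree r₂) (hH₂ : H₂.IsRegularOfDegree r₂)
    (hc₁ : Fintype.card V₁ = Fintype.card W₁) (hc₂ : Fintype.card V₂ = Fintype.card W₂)
    (φ : nsJoin G₁ G₂ ≃g nsJoin H₁ H₂) : Nonempty (G₂ ≃g H₂) := by
  have hright : ∀ x, (φ x).isRight ↔ x.isRight := fun x => by
    rw [← nsJoin_degree_eq_iff_isRight hH₁ hH₂, ← nsJoin_degree_eq_iff_isRight hG₁ hG₂,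
      φ.degree_eq]
  have hinr : ∀ u, ∃ w, φ (.inr u) = .inr w := fun u =>
    Sum.isRight_iff.1 ((hright (.inr u)).2 rfl)
  have hinl : ∀ x, ∃ y, φ (.inl x) = .inl y := fun x => by
    rcases h : φ (.inl x) with y | y
    · exact ⟨y, rfl⟩
    · have := (hright (.inl x)).1 (by rw [h]; rfl)
      simp at this
  choose t ht using fun v => hinl (.inr v)
  rcases Nat.eq_zero_or_pos r₁ with h0 | hpos
  · subst h0
    have hG : ∀ u u', ¬ G₁.Adj u u' := fun u u' h =>
      ((G₁.degree_pos_iff_exists_adj u).2 ⟨u', h⟩).ne' (hG₁ u)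
    have hH : ∀ u u', ¬ H₁.Adj u u' := fun u u' h =>
      ((H₁.degree_pos_iff_exists_adj u).2 ⟨u', h⟩).ne' (hH₁ u)
    by_cases hex : ∃ u w, φ (.inl (.inl u)) = .inl (.inl w)
    · obtain ⟨u₀, w₀, h₀⟩ := hex
      have : ∀ u, ∃ w, φ (.inl (.inl u)) = .inl (.inl w) := by
        intro u
        obtain ⟨w | w, hw⟩ := hinl (.inl u)
        · exact ⟨w, hw⟩
        -- Images on opposite sides would be adjacent, while `G₁` has no edges.
        · have := φ.map_adj_iff (v := .inl (.inl u₀)) (w := .inl (.inl u))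
          rw [h₀, hw] at this
          exact (hG _ _ (this.1 trivial)).elim
      choose s hs using this
      exact nonempty_iso_of_nsJoin_iso_of_inl hc₁ hc₂ φ t ht s hs
    · have : ∀ u, ∃ w, φ (.inl (.inl u)) = .inl (.inr w) := by
        intro u
        obtain ⟨w | w, hw⟩ := hinl (.inl u)
        · exact (hex ⟨u, w, hw⟩).elim
        · exact ⟨w, hw⟩
      choose s hs using this
      exact nonempty_iso_of_nsJoin_iso_of_inr hc₁ hc₂ hG hH φ t ht s hs
  · have : ∀ u, ∃ w, φ (.inl (.inl u)) = .inl (.inl w) := by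
      intro u
      obtain ⟨w | w, hw⟩ := hinl (.inl u)
      · exact ⟨w, hw⟩
      -- The new vertex of a neighbour of `u` is adjacent to `u`, but new vertices have no
      -- neighbours in the second factor.
      · obtain ⟨u', hu'⟩ := (G₁.degree_pos_iff_exists_adj u).1 (by rw [hG₁ u]; exact hpos)
        obtain ⟨w', hw'⟩ := hinr u'
        have := φ.map_adj_iff (v := .inr u') (w := .inl (.inl u))
        rw [hw, hw'] at this
        exact (this.2 hu'.symm).elim
    choose s hs using this
    exact nonempty_iso_of_nsJoin_iso_of_inl hc₁ hc₂ φ t ht s hs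

end Iso

/-! ### The four matrices, treated uniformly -/

/-- The coefficient of the identity in the matrix of kind `X` of an `r`-regular graph. -/
noncomputable def GraphMatrixKind.oneCoeff (X : GraphMatrixKind) (r : ℕ) : ℝ :=
  match X with
  | .adjacency => 0
  | .laplacian => r
  | .signlessLaplacian => r
  | .normalizedLaplacian => if r = 0 then 0 else 1

/-- The entry of the matrix of kind `X` at adjacent vertices of degrees `p` and `q`. -/
noncomputable def GraphMatrixKind.edgeEntry (X : GraphMatrixKind) (p q : ℕ) : ℝ :=
  match X with
  | .adjacency => 1
  | .laplacian => -1
  | .signlessLaplacian => 1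
  | .normalizedLaplacian => -(1 / Real.sqrt (p * q))

theorem graphMatrix_apply {V : Type*} [Fintype V] [DecidableEq V] (G : SimpleGraph V)
    [DecidableRel G.Adj] (X : GraphMatrixKind) (i j : V) :
    graphMatrix X G i j = (if G.Adj i j then X.edgeEntry (G.degree i) (G.degree j) else 0) +
      if i = j then X.oneCoeff (G.degree i) else 0 := by
  by_cases hij : i = j
  · subst hij
    cases X <;> simp [graphMatrix, GraphMatrixKind.oneCoeff, lapMatrix,
      signlessLapMatrix, normalizedLapMatrix, degMatrix]
  · cases X <;> simp [graphMatrix, GraphMatrixKind.edgeEntry, lapMatrix,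
      signlessLapMatrix, normalizedLapMatrix, degMatrix, hij]
    split_ifs <;> simp

theorem GraphMatrixKind.edgeEntry_comm (X : GraphMatrixKind) (p q : ℕ) :
    X.edgeEntry p q = X.edgeEntry q p := by
  cases X <;> simp [GraphMatrixKind.edgeEntry, mul_comm]

section Regular

variable {V : Type*} [Fintype V] [DecidableEq V] {G : SimpleGraph V} [DecidableRel G.Adj]

theorem graphMatrix_of_regular {r : ℕ} (h : G.IsRegularOfDegree r) (X : GraphMatrixKind) :
    graphMatrix X G = X.edgeEntry r r • G.adjMatrix ℝ + X.oneCoeff r • 1 := by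
  ext i j
  rw [graphMatrix_apply, h i, h j]
  simp [Matrix.one_apply]

theorem isHermitian_graphMatrix_of_regular {r : ℕ} (h : G.IsRegularOfDegree r)
    (X : GraphMatrixKind) : (graphMatrix X G).IsHermitian := by
  rw [graphMatrix_of_regular h, Matrix.IsHermitian]
  simp [conjTranspose_eq_transpose_of_trivial]

theorem graphMatrix_mulVec_one_of_regular {r : ℕ} (h : G.IsRegularOfDegree r)
    (X : GraphMatrixKind) :
    graphMatrix X G *ᵥ 1 = (X.edgeEntry r r * r + X.oneCoeff r) • 1 := by
  have h1 : G.adjMatrix ℝ *ᵥ 1 = (r : ℝ) • 1 := by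
    ext i
    rw [adjMatrix_mulVec_apply]
    simp [h i]
  rw [graphMatrix_of_regular h, add_mulVec, smul_mulVec, smul_mulVec, h1, one_mulVec, smul_smul,
    add_smul]

theorem adjMatrix_eq_zero_of_regular_zero {V : Type*} [Fintype V] {G : SimpleGraph V}
    [DecidableRel G.Adj] (h : G.IsRegularOfDegree 0) : G.adjMatrix ℝ = 0 := by
  ext i j
  have : ¬ G.Adj i j := fun hij => ((G.degree_pos_iff_exists_adj i).2 ⟨j, hij⟩).ne' (h i)
  simp [this]

end Regular

/-- Regular graphs of the same degree that are cospectral for one kind of matrix have adjacency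
matrices that are similar by an orthogonal matrix fixing the all-ones vector. -/
theorem exists_orthogonal_adjMatrix_of_cospectral {V W : Type*} [Fintype V] [DecidableEq V]
    [Fintype W] [DecidableEq W] {G : SimpleGraph V} [DecidableRel G.Adj] {H : SimpleGraph W}
    [DecidableRel H.Adj] {r : ℕ} (hG : G.IsRegularOfDegree r) (hH : H.IsRegularOfDegree r)
    {X : GraphMatrixKind} (h : Cospectral X G H) :
    ∃ P : Matrix W V ℝ, Pᵀ * P = 1 ∧ P * Pᵀ = 1 ∧ P *ᵥ 1 = 1 ∧
      P * G.adjMatrix ℝ = H.adjMatrix ℝ * P := by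
  obtain ⟨P, h1, h2, h3, h4⟩ := exists_orthogonal_fixing_one
    (isHermitian_graphMatrix_of_regular hG X) (isHermitian_graphMatrix_of_regular hH X) h _
    (graphMatrix_mulVec_one_of_regular hG X) (graphMatrix_mulVec_one_of_regular hH X)
  refine ⟨P, h1, h2, h3, ?_⟩
  -- For `r = 0` the normalized Laplacian has edge coefficient `-(1 / √0) = 0`, which cannot be
  -- cancelled; but then both adjacency matrices vanish.
  rcases Nat.eq_zero_or_pos r with rfl | hr
  · rw [adjMatrix_eq_zero_of_regular_zero hG, adjMatrix_eq_zero_of_regular_zero hH,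
      Matrix.mul_zero, Matrix.zero_mul]
  · rw [graphMatrix_of_regular hG, graphMatrix_of_regular hH, Matrix.mul_add, Matrix.add_mul,
      Matrix.mul_smul, Matrix.smul_mul, Matrix.mul_smul, Matrix.smul_mul, Matrix.mul_one,
      Matrix.one_mul, add_left_inj] at h4
    have hne : X.edgeEntry r r ≠ 0 := by
      cases X <;> simp [GraphMatrixKind.edgeEntry, hr.ne']
    exact smul_right_injective _ hne h4

theorem card_eq_of_cospectral {V W : Type*} [Fintype V] [DecidableEq V]
    [Fintype W] [DecidableEq W] {G : SimpleGraph V} [DecidableRel G.Adj] {H : SimpleGraph W}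
    [DecidableRel H.Adj] {r : ℕ} (hG : G.IsRegularOfDegree r) (hH : H.IsRegularOfDegree r)
    {X : GraphMatrixKind} (h : Cospectral X G H) : Fintype.card V = Fintype.card W :=
  card_eq_of_roots_charpoly_eq (isHermitian_graphMatrix_of_regular hG X)
    (isHermitian_graphMatrix_of_regular hH X) h

/-- Keeping the degrees `p`, `q` as variables lets both joins receive literally the same
coefficients. -/
theorem graphMatrix_nsJoin {V₁ V₂ : Type*} [Fintype V₁] [DecidableEq V₁] [Fintype V₂]
    [DecidableEq V₂] {G₁ : SimpleGraph V₁} [DecidableRel G₁.Adj] {G₂ : SimpleGraph V₂}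
    [DecidableRel G₂.Adj] {r₁ r₂ p q : ℕ} (h₁ : G₁.IsRegularOfDegree r₁)
    (h₂ : G₂.IsRegularOfDegree r₂) (hp : 2 * r₁ + Fintype.card V₂ = p)
    (hq : r₂ + Fintype.card V₁ = q) (X : GraphMatrixKind) :
    graphMatrix X (nsJoin G₁ G₂) =
      nsBlock (X.edgeEntry p p) (X.oneCoeff p) (X.edgeEntry p q) (X.edgeEntry p r₁)
        (X.edgeEntry q q) (X.oneCoeff q) (X.oneCoeff r₁) (G₁.adjMatrix ℝ) (G₂.adjMatrix ℝ) := by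
  subst hp hq
  ext ((i | i) | i) ((j | j) | j) <;>
    simp [graphMatrix_apply, nsBlock, nsJoin_degree_inl_inl h₁, nsJoin_degree_inl_inr h₂,
      nsJoin_degree_inr h₁, Matrix.one_apply, X.edgeEntry_comm r₁,
      X.edgeEntry_comm (r₂ + _) (2 * _ + _), G₁.adj_comm]

theorem mainTheorem7 {V₁ V₂ W₁ W₂ : Type*}
    [Fintype V₁] [DecidableEq V₁] [Fintype V₂] [DecidableEq V₂]
    [Fintype W₁] [DecidableEq W₁] [Fintype W₂] [DecidableEq W₂]
    [Nonempty V₁]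
    (G₁ : SimpleGraph V₁) [DecidableRel G₁.Adj] (G₂ : SimpleGraph V₂) [DecidableRel G₂.Adj]
    (H₁ : SimpleGraph W₁) [DecidableRel H₁.Adj] (H₂ : SimpleGraph W₂) [DecidableRel H₂.Adj]
    (r₁ r₂ : ℕ)
    (hG₁ : G₁.IsRegularOfDegree r₁) (hH₁ : H₁.IsRegularOfDegree r₁)
    (hG₂ : G₂.IsRegularOfDegree r₂) (hH₂ : H₂.IsRegularOfDegree r₂)
    -- cospectrality of each pair is required for just one of the four matrices
    (hcosp₁ : ∃ X : GraphMatrixKind, Cospectral X G₁ H₁)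
    (hcosp₂ : ∃ X : GraphMatrixKind, Cospectral X G₂ H₂)
    (hniso : IsEmpty (G₂ ≃g H₂)) :
    (¬ ∃ d : ℕ, (nsJoin G₁ G₂).IsRegularOfDegree d) ∧
    (¬ ∃ d : ℕ, (nsJoin H₁ H₂).IsRegularOfDegree d) ∧
    IsEmpty (nsJoin G₁ G₂ ≃g nsJoin H₁ H₂) ∧
    ∀ X : GraphMatrixKind, Cospectral X (nsJoin G₁ G₂) (nsJoin H₁ H₂) := by
  obtain ⟨X₁, hX₁⟩ := hcosp₁
  obtain ⟨X₂, hX₂⟩ := hcosp₂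
  have hc₁ := card_eq_of_cospectral hG₁ hH₁ hX₁
  have hc₂ := card_eq_of_cospectral hG₂ hH₂ hX₂
  -- Two graphs without vertices would be isomorphic.
  have hV₂ : Nonempty V₂ := by
    by_contra hV
    rw [not_nonempty_iff] at hV
    exact (nonempty_iso_of_injective hc₂ (fun v => (hV.false v).elim)
      (fun v => (hV.false v).elim) (fun v => (hV.false v).elim) :
        Nonempty (G₂ ≃g H₂)).elim hniso.false
  have hW₁ : Nonempty W₁ := Fintype.card_pos_iff.1 (hc₁ ▸ Fintype.card_pos)
  have hW₂ : Nonempty W₂ := Fintype.card_pos_iff.1 (hc₂ ▸ Fintype.card_pos)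
  refine ⟨not_isRegularOfDegree_nsJoin hG₁, not_isRegularOfDegree_nsJoin hH₁,
    ⟨fun φ => (nonempty_iso_of_nsJoin_iso hG₁ hH₁ hG₂ hH₂ hc₁ hc₂ φ).elim hniso.false⟩,
    fun X => ?_⟩
  obtain ⟨P₁, h1, h2, h3, h4⟩ := exists_orthogonal_adjMatrix_of_cospectral hG₁ hH₁ hX₁
  obtain ⟨P₂, k1, k2, k3, k4⟩ := exists_orthogonal_adjMatrix_of_cospectral hG₂ hH₂ hX₂
  rw [Cospectral, graphSpectrum, graphSpectrum, graphMatrix_nsJoin hG₁ hG₂ rfl rfl X,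
    graphMatrix_nsJoin hH₁ hH₂ (by rw [← hc₂]) (by rw [← hc₁]) X,
    charpoly_nsBlock_eq hc₁ hc₂ h1 h2 h3 h4 k1 k2 k3 k4]
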